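/- Let $(\mathcal A,\varphi)$ be a noncommutative probability space, i.e. a von Neumann algebra $\mathcal A$ with a faithful normal tracial state $\varphi$. Unital subalgebras $\mathcal A_1,\mathcal A_2\subseteq\mathcal A$ are called free if $\varphi(a_1\cdots a_m)=0$ whenever $m\ge1$, each $a_k\in\mathcal A_{i_k}$ satisfies $\varphi(a_k)=0$, and $i_k\neq i_{k+1}$ for all $k<m$; families of elements are free if the unital subalgebras they generate are free. The Boolean cumulants $\beta_m:\mathcal A^m\to\mathbb C$ $(m\ge1)$ are the functionals determined by $$\varphi(a_1\cdots a_m)=\sum_{\pi}\ \prod_{B\in\pi}\beta_{|B|}(a_i;\,i\in B),$$ where $\pi$ runs over the partitions of $\{1,\dots,m\}$ into intervals. Let $n\ge1$ and $X_1,\dots,X_n,Y_1,\dots,Y_n\in\mathcal A$. In the sums below, for each $0<i_1<\dots<i_k<n$ we put $i_0=0$ and $i_{k+1}=n$; an empty product in $\mathcal A$ is $1$. (a) If the families $(X_1,\dots,X_n)$ and $(Y_1,\dots,Y_n)$ are free, then $$\varphi(X_1Y_1\cdots X_nY_n)=\sum_{k=0}^{n-1}\ \sum_{0<i_1<\dots<i_k<n}\varphi(Y_{i_1}\cdots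 Y_{i_k}Y_n)\prod_{j=0}^{k}\beta_{2(i_{j+1}-i_j)-1}(X_{i_j+1},Y_{i_j+1},X_{i_j+2},\dots,Y_{i_{j+1}-1},X_{i_{j+1}}).$$ (b) Let $\mathcal B\subseteq\mathcal A$ be a unital $*$-subalgebra (for instance a von Neumann subalgebra) that contains $Y_1,\dots,Y_{n-1}$ and is free from $\{X_1,\dots,X_n\}$. Then the conditional expectation onto $\mathcal B$ is given on the alternating word by $$E[X_1Y_1X_2\cdots Y_{n-1}X_n\,|\,\mathcal B]=\sum_{k=0}^{n-1}\ \sum_{0<i_1<\dots<i_k<n}Y_{i_1}\cdots Y_{i_k}\prod_{j=0}^{k}\beta_{2(i_{j+1}-i_j)-1}(X_{i_j+1},Y_{i_j+1},X_{i_j+2},\dots,Y_{i_{j+1}-1},X_{i_{j+1}}).$$ That is, the right-hand side is the unique $Z\in\mathcal B$ with $\varphi(X_1Y_1\cdots Y_{n-1}X_n\,b)=\varphi(Zb)$ for all $b\in\mathcal B$; and $E(X_1Y_1\cdots Y_{n-1}X_n)$ equals it for every linear projection $E$ of $\mathcal A$ onto $\mathcal B$ that is a $\mathcal B$-bimodule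 map with $\varphi\circ E=\varphi$. -/

import Mathlib

open scoped ComplexOrder

namespace FreeProb

/-- `φ` is a faithful, normal, tracial state on the `C⋆`-algebra `A` (which will be a von Neumann
algebra).  Positivity is expressed with the order of `ℂ` (`0 ≤ z` means: `z` is real and
nonnegative); normality means that `φ` preserves suprema of upward directed sets of positive
elements. -/
structure IsFaithfulNormalTracialState {A : Type*} [CStarAlgebra A] [PartialOrder A]
    [StarOrderedRing A] (φ : A →ₗ[ℂ] ℂ) : Prop where
  map_one : φ 1 = 1
  nonneg : ∀ a : A, 0 ≤ φ (star a * a)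
  faithful : ∀ a : A, φ (star a * a) = 0 → a = 0
  tracial : ∀ a b : A, φ (a * b) = φ (b * a)
  normal : ∀ S : Set A, S.Nonempty → DirectedOn (· ≤ ·) S → (∀ a ∈ S, 0 ≤ a) →
    ∀ s : A, IsLUB S s → IsLUB ((fun a => (φ a).re) '' S) (φ s).re

/-- Compositions of `n + 1`, sorted by their first part. -/
theorem sum_composition_succ (n : ℕ) (F : List ℕ → ℂ) :
    ∑ c : Composition (n + 1), F c.blocks =
      ∑ k : Fin (n + 1), ∑ c : Composition (n - k), F ((k + 1) :: c.blocks) := by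
  rw [← Fintype.sum_sigma' (fun (k : Fin (n + 1)) (c : Composition (n - k)) =>
    F ((k + 1) :: c.blocks))]
  symm
  refine Fintype.sum_bijective
    (fun p : (Σ k : Fin (n + 1), Composition (n - k)) =>
      (⟨(p.1 + 1) :: p.2.blocks, by
          intro i hi
          rcases List.mem_cons.1 hi with h | h
          · omega
          · exact p.2.blocks_pos h, by
          have := p.1.2
          simp only [List.sum_cons, Composition.blocks_sum]
          omega⟩ : Composition (n + 1))) ⟨?_, ?_⟩ _ _ (fun _ => rfl)
  · rintro ⟨k, c⟩ ⟨k', c'⟩ h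
    have h2 := congrArg Composition.blocks h
    simp only [List.cons.injEq, Nat.add_right_cancel_iff] at h2
    obtain ⟨h3, h4⟩ := h2
    obtain rfl := Fin.ext h3
    obtain rfl := Composition.ext h4
    rfl
  · rintro ⟨b, hpos, hsum⟩
    cases b with
    | nil => simp at hsum
    | cons x t =>
      have hx : 0 < x := hpos (by simp)
      simp only [List.sum_cons] at hsum
      refine ⟨⟨⟨x - 1, by omega⟩, ⟨t, fun h => hpos (by simp [h]), by simp only; omega⟩⟩, ?_⟩
      apply Composition.ext
      simp only [List.cons.injEq, and_true]
      omega

/-- Splitting off the first block in a sum over interval partitions. -/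
theorem sum_splitWrtComposition {α : Type*} (β : List α → ℂ) (l : List α) (hl : l ≠ []) :
    ∑ c : Composition l.length, ((l.splitWrtComposition c).map β).prod =
      ∑ k : Fin l.length, β (l.take (k + 1)) *
        ∑ c : Composition (l.drop (k + 1)).length,
          (((l.drop (k + 1)).splitWrtComposition c).map β).prod := by
  obtain ⟨n, hn⟩ : ∃ n, l.length = n + 1 :=
    Nat.exists_eq_succ_of_ne_zero (by simpa using hl)
  have key : ∀ m, m = n + 1 →
      ∑ c : Composition m, ((l.splitWrtCompositionAux c.blocks).map β).prod =
      ∑ k : Fin m, β (l.take (k + 1)) *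
        ∑ c : Composition (m - (k + 1)),
          (((l.drop (k + 1)).splitWrtCompositionAux c.blocks).map β).prod := by
    rintro _ rfl
    rw [sum_composition_succ n (fun b => ((l.splitWrtCompositionAux b).map β).prod)]
    refine Finset.sum_congr rfl fun k _ => ?_
    have e : n + 1 - ((k : ℕ) + 1) = n - k := by omega
    rw [e, Finset.mul_sum]
    refine Finset.sum_congr rfl fun c _ => ?_
    simp [List.splitWrtCompositionAux]
  have h := key l.length hn
  refine h.trans (Finset.sum_congr rfl fun k _ => ?_)
  have e : (l.drop ((k : ℕ) + 1)).length = l.length - (k + 1) := List.length_drop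
  simp only [List.splitWrtComposition]
  rw [e]

/-- The list `[X_{a+1}, Y_{a+1}, X_{a+2}, Y_{a+2}, …, X_{b-1}, Y_{b-1}, X_b]`, of length
`2 (b - a) - 1` for `a < b`. -/
def altList {A : Type*} (X Y : ℕ → A) (a b : ℕ) : List A :=
  (List.Ico (a + 1) b).flatMap (fun r => [X r, Y r]) ++ [X b]

theorem length_altList {A : Type*} (X Y : ℕ → A) {a b : ℕ} (h : a < b) :
    (altList X Y a b).length = 2 * (b - a) - 1 := by
  simp [altList, List.length_flatMap]
  omega

/-- For `s = {i₁ < ⋯ < i_k}` this is `i_j`, with the conventions `i₀ = 0` and `i_{k+1} = n`. -/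
def cut (n : ℕ) (s : Finset ℕ) (j : ℕ) : ℕ :=
  (0 :: (s.sort (· ≤ ·) ++ [n])).getD j 0

section Algebraic

variable {A : Type*} [Ring A] [Algebra ℂ A]

/-- Freeness of a family of unital subalgebras `𝒜 i` with respect to `φ`: `φ (a₁ ⋯ aₘ) = 0`
whenever `m ≥ 1`, each `aₖ` is a centered element of `𝒜 (iₖ)`, and `iₖ ≠ iₖ₊₁` for all `k < m`.
The list `w` is `[(i₁, a₁), …, (iₘ, aₘ)]`. -/
def IsFree {ι : Type*} (φ : A →ₗ[ℂ] ℂ) (𝒜 : ι → Subalgebra ℂ A) : Prop :=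
  ∀ w : List (ι × A), w ≠ [] →
    (∀ p ∈ w, p.2 ∈ 𝒜 p.1 ∧ φ p.2 = 0) →
    w.IsChain (fun p q => p.1 ≠ q.1) →
    φ (w.map Prod.snd).prod = 0

/-- The Boolean cumulant `β_m(a₁, …, aₘ)` of the list `[a₁, …, aₘ]`, `m ≥ 1` (the order `m` is the
length of the list).  It is computed by the recursion
`φ(a₁ ⋯ aₘ) = ∑_{j = 1}^{m} β_j(a₁, …, a_j) φ(a_{j+1} ⋯ aₘ)`.  The theorem
`moment_eq_sum_booleanCumulant` below is the defining moment-cumulant formula over interval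
partitions, and `eq_booleanCumulant_of_moment_eq` says that it determines the Boolean cumulants.
(On the empty list the value is irrelevant.) -/
noncomputable def booleanCumulant (φ : A →ₗ[ℂ] ℂ) (l : List A) : ℂ :=
  φ l.prod -
    ∑ j : Fin (l.length - 1),
      booleanCumulant φ (l.take (j + 1)) * φ (l.drop (j + 1)).prod
termination_by l.length
decreasing_by
  have := j.2
  simp only [List.length_take]
  omega

/-- The defining recursion of the Boolean cumulants. -/
theorem booleanCumulant_recursion (φ : A →ₗ[ℂ] ℂ) (h1 : φ 1 = 1) (l : List A) (hl : l ≠ []) :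
    φ l.prod = ∑ k : Fin l.length,
      booleanCumulant φ (l.take (k + 1)) * φ (l.drop (k + 1)).prod := by
  obtain ⟨n, hn⟩ : ∃ n, l.length = n + 1 :=
    Nat.exists_eq_succ_of_ne_zero (by simpa using hl)
  have hb := booleanCumulant.eq_1 φ l
  rw [Finset.sum_fin_eq_sum_range] at hb ⊢
  rw [hn] at hb ⊢
  rw [Finset.sum_range_succ]
  simp only [Nat.add_sub_cancel] at hb
  have e1 : l.take (n + 1) = l := by rw [← hn]; simp
  have e2 : l.drop (n + 1) = [] := by rw [← hn]; simp
  rw [dif_pos (Nat.lt_succ_self n)]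
  simp only [e1, e2, List.prod_nil, h1, mul_one]
  rw [hb]
  have : ∀ i ∈ Finset.range n,
      (if h : i < n + 1 then booleanCumulant φ (l.take (i + 1)) * φ (l.drop (i + 1)).prod else 0)
      = (if h : i < n then booleanCumulant φ (l.take (i + 1)) * φ (l.drop (i + 1)).prod
          else 0) := by
    intro i hi
    have := Finset.mem_range.1 hi
    rw [dif_pos this, dif_pos (by omega)]
  rw [Finset.sum_congr rfl this]
  ring

/-- The moment-cumulant formula `φ(a₁ ⋯ aₘ) = ∑_{π ∈ IP(m)} β_π(a₁, …, aₘ)`; the interval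
partitions of `[m]` are the compositions of `m`, and `l.splitWrtComposition c` is the list of
the restrictions of `l` to the blocks of `c`. -/
theorem moment_eq_sum_booleanCumulant (φ : A →ₗ[ℂ] ℂ) (h1 : φ 1 = 1) (l : List A) :
    φ l.prod =
      ∑ c : Composition l.length,
        ((l.splitWrtComposition c).map (booleanCumulant φ)).prod := by
  induction hn : l.length using Nat.strong_induction_on generalizing l with
  | _ n ih =>
    subst hn
    by_cases hl : l = []
    · subst hl
      have : ∀ c : Composition ([] : List A).length, c.blocks = [] := by
        intro c
        by_contra h
        obtain ⟨x, hx⟩ := List.exists_mem_of_ne_nil _ h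
        have h3 := c.blocks_pos hx
        have h4 := List.le_sum_of_mem hx
        rw [c.blocks_sum] at h4
        simp at h4
        omega
      have hu : ∀ c : Composition ([] : List A).length,
          ((([] : List A).splitWrtComposition c).map (booleanCumulant φ)).prod = 1 := by
        intro c
        simp [List.splitWrtComposition, this c, List.splitWrtCompositionAux]
      rw [Finset.sum_congr rfl fun c _ => hu c]
      simp [h1, composition_card]
    · rw [sum_splitWrtComposition _ l hl, booleanCumulant_recursion φ h1 l hl]
      refine Finset.sum_congr rfl fun k _ => ?_
      congr 1
      refine ih _ ?_ _ rfl
      have := k.2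
      rw [List.length_drop]
      omega

/-- The moment-cumulant formula determines the Boolean cumulants. -/
theorem eq_booleanCumulant_of_moment_eq (φ : A →ₗ[ℂ] ℂ) (h1 : φ 1 = 1) (β : List A → ℂ)
    (hβ : ∀ l : List A, φ l.prod =
      ∑ c : Composition l.length, ((l.splitWrtComposition c).map β).prod)
    (l : List A) (hl : l ≠ []) : β l = booleanCumulant φ l := by
  induction hn : l.length using Nat.strong_induction_on generalizing l with
  | _ n ih =>
    subst hn
    have h2 := booleanCumulant_recursion φ h1 l hl
    rw [hβ l, sum_splitWrtComposition β l hl] at h2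
    simp only [← hβ] at h2
    obtain ⟨n, hn⟩ : ∃ n, l.length = n + 1 :=
      Nat.exists_eq_succ_of_ne_zero (by simpa using hl)
    rw [Finset.sum_fin_eq_sum_range, Finset.sum_fin_eq_sum_range, hn,
      Finset.sum_range_succ, Finset.sum_range_succ] at h2
    have e1 : l.take (n + 1) = l := by rw [← hn]; simp
    have e2 : l.drop (n + 1) = [] := by rw [← hn]; simp
    rw [dif_pos (Nat.lt_succ_self n), dif_pos (Nat.lt_succ_self n)] at h2
    simp only [e1, e2, List.prod_nil, h1, mul_one] at h2
    refine add_left_cancel (h2.trans ?_ |>.trans rfl)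
    congr 1
    refine Finset.sum_congr rfl fun i hi => ?_
    have hi' := Finset.mem_range.1 hi
    rw [dif_pos (by omega), dif_pos (by omega), ih _ ?_ _ ?_ rfl]
    · rw [List.length_take]; omega
    · intro h0
      have h3 := congrArg List.length h0
      rw [List.length_take, List.length_nil] at h3
      omega

/-- For `s = {i₁ < ⋯ < i_k}` this is the weight
`∏_{j=0}^{k} β_{2(i_{j+1} - i_j) - 1}(X_{i_j+1}, Y_{i_j+1}, …, X_{i_{j+1}})`. -/
noncomputable def cumulantWeight (φ : A →ₗ[ℂ] ℂ) (X Y : ℕ → A) (n : ℕ) (s : Finset ℕ) : ℂ :=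
  ∏ j ∈ Finset.range (s.card + 1),
    booleanCumulant φ (altList X Y (cut n s j) (cut n s (j + 1)))

/-- For `s = {i₁ < ⋯ < i_k}` this is the product `Y_{i₁} ⋯ Y_{i_k}` (equal to `1` for `k = 0`). -/
noncomputable def orderedProd (Y : ℕ → A) (s : Finset ℕ) : A :=
  ((s.sort (· ≤ ·)).map Y).prod

/-- `z` is a conditional expectation of the element `a` given the subalgebra `B`:
`z ∈ B` and `φ (a b) = φ (z b)` for all `b ∈ B`. -/
def IsCondExpOf [StarRing A] [StarModule ℂ A] (φ : A →ₗ[ℂ] ℂ) (B : StarSubalgebra ℂ A)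
    (a z : A) : Prop :=
  z ∈ B ∧ ∀ b ∈ B, φ (a * b) = φ (z * b)

/-- `E` is a conditional expectation map onto `B` with respect to `φ`: a linear projection of `A`
onto `B` which is a `B`-bimodule map and preserves `φ`. -/
structure IsConditionalExpectation [StarRing A] [StarModule ℂ A] (φ : A →ₗ[ℂ] ℂ)
    (B : StarSubalgebra ℂ A) (E : A →ₗ[ℂ] A) : Prop where
  mem : ∀ a, E a ∈ B
  proj : ∀ b ∈ B, E b = b
  bimodule : ∀ b ∈ B, ∀ c ∈ B, ∀ a, E (b * a * c) = b * E a * c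
  preserves : ∀ a, φ (E a) = φ a

end Algebraic

end FreeProb

/-!
The Boolean cumulants have an operator description. Put `C [] = 1` and
`C (a :: l) = a * C l - φ (a * C l)`, so that `C l` is built from right to left by multiplying by the
next letter and removing the mean. Then `β (a :: l) = φ (a * C l)`
(`booleanCumulant_cons_eq`).

Let `𝒜` be a free family and let `W` be the span of the products of alternating centered words
whose last letter lies in `𝒜 j`. Multiplying an element of `W` from the left by an element of
some `𝒜 i` stays in `W` up to a scalar, and the scalar is zero if `i ≠ j`: it can only appear when
the letter is absorbed into a word of length one. Hence `C l ∈ W` whenever the letters of `l`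
lie in the algebras of the family and the last one lies in `𝒜 j`. Since `φ` vanishes on `W`, a Boolean
cumulant vanishes if its first and last entries come from different algebras
(`booleanCumulant_eq_zero_of_isFree`).

Now expand `φ (X_{a+1} Y_{a+1} ⋯ X_n b)` according to the first block of the interval partition.
Only the blocks that end at some `X_i` contribute, and by traciality the rest of the word
contributes `φ (X_{i+1} Y_{i+1} ⋯ X_n (b Y_i))`, a moment of the same form. Induction gives the formula
for `φ (X_1 Y_1 ⋯ X_n b)` with `b` in the second algebra (`moment_altList_mul`). Part (a) is the case
`b = Y_n`. In part (b), the formula for all `b ∈ B` says that the right-hand side represents the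
conditional expectation, which is unique because `φ` is faithful.
-/

namespace FreeProb

section Algebraic

variable {A : Type*} [Ring A] [Algebra ℂ A]

/-! ### Boolean cumulants as moments of successively centered products -/

/-- The product of a list, centered with respect to `φ` after each multiplication from the left;
the empty list gives `1`. -/
noncomputable def centeredProd (φ : A →ₗ[ℂ] ℂ) : List A → A
  | [] => 1
  | a :: l => a * centeredProd φ l - algebraMap ℂ A (φ (a * centeredProd φ l))

theorem map_mul_prod_eq_sum_centeredProd (φ : A →ₗ[ℂ] ℂ) (h1 : φ 1 = 1) (x : A) (l : List A) :
    φ (x * l.prod) = ∑ k ∈ Finset.range (l.length + 1),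
      φ (x * centeredProd φ (l.take k)) * φ (l.drop k).prod := by
  induction l generalizing x with
  | nil => simp [centeredProd, h1]
  | cons a l ih =>
    have step : ∀ m : List A, φ (x * centeredProd φ (a :: m)) =
        φ (x * a * centeredProd φ m) - φ (a * centeredProd φ m) * φ x := by
      intro m
      rw [centeredProd, mul_sub, map_sub, ← Algebra.commutes, ← Algebra.smul_def, map_smul,
        smul_eq_mul, mul_assoc]
    rw [List.length_cons, Finset.sum_range_succ']
    simp only [List.take_succ_cons, List.drop_succ_cons, List.take_zero, List.drop_zero, step,
      sub_mul, Finset.sum_sub_distrib]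
    have h2 := ih a
    rw [← List.prod_cons] at h2
    have h3 : ∑ k ∈ Finset.range (l.length + 1),
        φ (a * centeredProd φ (l.take k)) * φ x * φ (l.drop k).prod =
          φ x * φ (a :: l).prod := by
      rw [h2, Finset.mul_sum]
      exact Finset.sum_congr rfl fun k _ => by ring
    rw [h3, ← ih (x * a), List.prod_cons, mul_assoc]
    simp [centeredProd]

theorem booleanCumulant_cons_eq (φ : A →ₗ[ℂ] ℂ) (h1 : φ 1 = 1) (a : A) (l : List A) :
    booleanCumulant φ (a :: l) = φ (a * centeredProd φ l) := by
  induction hn : l.length using Nat.strong_induction_on generalizing l with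
  | _ n ih =>
    subst hn
    have hm := map_mul_prod_eq_sum_centeredProd φ h1 a l
    rw [Finset.sum_range_succ, List.take_length, List.drop_length, List.prod_nil, h1,
      mul_one] at hm
    rw [booleanCumulant.eq_1, List.prod_cons, hm, sub_eq_iff_eq_add', add_left_inj]
    simp only [List.length_cons, List.take_succ_cons, List.drop_succ_cons]
    rw [Finset.sum_range]
    refine Finset.sum_congr rfl fun k _ => ?_
    rw [ih (l.take k).length (by rw [List.length_take]; omega) _ rfl]

/-! ### Vanishing of mixed Boolean cumulants -/

/-- The span of the products of nonempty alternating centered words in the algebras `𝒜 i` whose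
last letter lies in `𝒜 j`. -/
def alternatingSpan {ι : Type*} (φ : A →ₗ[ℂ] ℂ) (𝒜 : ι → Subalgebra ℂ A) (j : ι) :
    Submodule ℂ A :=
  Submodule.span ℂ {x | ∃ (w : List (ι × A)) (h : w ≠ []),
    (∀ p ∈ w, p.2 ∈ 𝒜 p.1 ∧ φ p.2 = 0) ∧ w.IsChain (fun p q => p.1 ≠ q.1) ∧
      (w.getLast h).1 = j ∧ (w.map Prod.snd).prod = x}

variable {ι : Type*} {φ : A →ₗ[ℂ] ℂ} {𝒜 : ι → Subalgebra ℂ A}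

theorem map_eq_zero_of_mem_alternatingSpan (hfree : IsFree φ 𝒜) {j : ι} {x : A}
    (hx : x ∈ alternatingSpan φ 𝒜 j) : φ x = 0 := by
  have : alternatingSpan φ 𝒜 j ≤ LinearMap.ker φ := by
    refine Submodule.span_le.2 ?_
    rintro _ ⟨w, h, hc, ha, -, rfl⟩
    exact hfree w h hc ha
  exact this hx

theorem center_mem (φ : A →ₗ[ℂ] ℂ) {S : Subalgebra ℂ A} {a : A} (ha : a ∈ S) :
    a - algebraMap ℂ A (φ a) ∈ S :=
  S.sub_mem ha (S.algebraMap_mem _)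

theorem map_algebraMap_of_map_one (h1 : φ 1 = 1) (c : ℂ) : φ (algebraMap ℂ A c) = c := by
  rw [Algebra.algebraMap_eq_smul_one, map_smul, h1, smul_eq_mul, mul_one]

theorem map_center (h1 : φ 1 = 1) (a : A) : φ (a - algebraMap ℂ A (φ a)) = 0 := by
  rw [map_sub, map_algebraMap_of_map_one h1, sub_self]

theorem center_mem_alternatingSpan (h1 : φ 1 = 1) {j : ι} {a : A} (ha : a ∈ 𝒜 j) :
    a - algebraMap ℂ A (φ a) ∈ alternatingSpan φ 𝒜 j :=
  Submodule.subset_span ⟨[(j, a - algebraMap ℂ A (φ a))], by simp,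
    fun p hp => List.mem_singleton.1 hp ▸ ⟨center_mem φ ha, map_center h1 a⟩, by simp, by simp, by simp⟩

/-- Left multiplication by an element of one of the algebras preserves the span up to a scalar,
and the scalar can only be nonzero if the element comes from the algebra of the last letters. -/
theorem exists_mul_sub_mem_alternatingSpan (h1 : φ 1 = 1) {i j : ι} {a x : A}
    (ha : a ∈ 𝒜 i) (hx : x ∈ alternatingSpan φ 𝒜 j) :
    ∃ c : ℂ, (i ≠ j → c = 0) ∧ a * x - algebraMap ℂ A c ∈ alternatingSpan φ 𝒜 j := by
  induction hx using Submodule.span_induction with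
  | zero => exact ⟨0, by simp⟩
  | add x y _ _ hx hy =>
    obtain ⟨c, hc, hx⟩ := hx
    obtain ⟨d, hd, hy⟩ := hy
    refine ⟨c + d, fun h => by rw [hc h, hd h, add_zero], ?_⟩
    convert add_mem hx hy using 1
    rw [mul_add, map_add]
    abel
  | smul r x _ hx =>
    obtain ⟨c, hc, hx⟩ := hx
    refine ⟨r * c, fun h => by rw [hc h, mul_zero], ?_⟩
    convert Submodule.smul_mem _ r hx using 1
    rw [smul_sub, mul_smul_comm, map_mul, Algebra.smul_def r (algebraMap ℂ A c)]
  | mem x hx =>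
    obtain ⟨w, hw, hc, hch, hl, rfl⟩ := hx
    obtain ⟨⟨i', y⟩, v, rfl⟩ := List.exists_cons_of_ne_nil hw
    have hy := hc (i', y) (by simp)
    by_cases hi : i = i'
    · -- The letter is absorbed into the first letter of the word.
      subst hi
      have hay : a * y ∈ 𝒜 i := (𝒜 i).mul_mem ha hy.1
      by_cases hv : v = []
      · subst hv
        obtain rfl : i = j := by simpa using hl
        refine ⟨φ (a * y), fun h => absurd rfl h, ?_⟩
        simpa using center_mem_alternatingSpan h1 hay
      · refine ⟨0, fun _ => rfl, ?_⟩
        have e : a * (((i, y) :: v).map Prod.snd).prod - algebraMap ℂ A 0 =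
            (((i, a * y - algebraMap ℂ A (φ (a * y))) :: v).map Prod.snd).prod +
              φ (a * y) • (v.map Prod.snd).prod := by
          simp only [List.map_cons, List.prod_cons, map_zero, sub_zero, sub_mul, mul_assoc,
            Algebra.smul_def, sub_add_cancel]
        rw [e]
        have hlv : (v.getLast hv).1 = j := by
          rwa [List.getLast_cons hv] at hl
        refine add_mem (Submodule.subset_span ⟨_, by simp, ?_, ?_, ?_, rfl⟩)
          (Submodule.smul_mem _ _ (Submodule.subset_span
            ⟨v, hv, fun p hp => hc p (by simp [hp]), ?_, hlv, rfl⟩))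
        · intro p hp
          rcases List.mem_cons.1 hp with rfl | hp
          · exact ⟨center_mem φ hay, map_center h1 _⟩
          · exact hc p (by simp [hp])
        · rw [List.isChain_cons] at hch ⊢
          exact hch
        · rwa [List.getLast_cons hv]
        · exact (List.isChain_cons.1 hch).2
    · refine ⟨0, fun _ => rfl, ?_⟩
      have e : a * (((i', y) :: v).map Prod.snd).prod - algebraMap ℂ A 0 =
          (((i, a - algebraMap ℂ A (φ a)) :: (i', y) :: v).map Prod.snd).prod +
            φ a • (((i', y) :: v).map Prod.snd).prod := by
        rw [List.map_cons (a := (i, _)), List.prod_cons (a := a - _), sub_mul, map_zero,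
          sub_zero, Algebra.smul_def, sub_add_cancel]
      rw [e]
      refine add_mem (Submodule.subset_span ⟨_, by simp, ?_, ?_, ?_, rfl⟩)
        (Submodule.smul_mem _ _ (Submodule.subset_span ⟨_, hw, hc, hch, hl, rfl⟩))
      · intro p hp
        rcases List.mem_cons.1 hp with rfl | hp
        · exact ⟨center_mem φ ha, map_center h1 _⟩
        · exact hc p hp
      · exact List.isChain_cons_cons.2 ⟨hi, hch⟩
      · rwa [List.getLast_cons hw]

theorem mul_mem_alternatingSpan (h1 : φ 1 = 1) {i j : ι} (hij : i ≠ j) {a x : A}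
    (ha : a ∈ 𝒜 i) (hx : x ∈ alternatingSpan φ 𝒜 j) : a * x ∈ alternatingSpan φ 𝒜 j := by
  obtain ⟨c, hc, h⟩ := exists_mul_sub_mem_alternatingSpan h1 ha hx
  simpa [hc hij] using h

theorem center_mul_mem_alternatingSpan (h1 : φ 1 = 1) (hfree : IsFree φ 𝒜) {i j : ι} {a x : A}
    (ha : a ∈ 𝒜 i) (hx : x ∈ alternatingSpan φ 𝒜 j) :
    a * x - algebraMap ℂ A (φ (a * x)) ∈ alternatingSpan φ 𝒜 j := by
  obtain ⟨c, -, h⟩ := exists_mul_sub_mem_alternatingSpan h1 ha hx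
  have h0 := map_eq_zero_of_mem_alternatingSpan hfree h
  rw [map_sub, map_algebraMap_of_map_one h1, sub_eq_zero] at h0
  rwa [h0]

theorem centeredProd_mem_alternatingSpan (h1 : φ 1 = 1) (hfree : IsFree φ 𝒜) {j : ι}
    {l : List A} (hl : ∀ a ∈ l, ∃ i, a ∈ 𝒜 i) {b : A} (hb : b ∈ 𝒜 j) :
    centeredProd φ (l ++ [b]) ∈ alternatingSpan φ 𝒜 j := by
  induction l with
  | nil => simpa [centeredProd] using center_mem_alternatingSpan h1 hb
  | cons a l ih =>
    obtain ⟨i, hi⟩ := hl a (by simp)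
    exact center_mul_mem_alternatingSpan h1 hfree hi (ih fun x hx => hl x (by simp [hx]))

/-- A Boolean cumulant of elements of free algebras vanishes if its first and last entries come
from different algebras. -/
theorem booleanCumulant_eq_zero_of_isFree (h1 : φ 1 = 1) (hfree : IsFree φ 𝒜) {i j : ι}
    (hij : i ≠ j) {a b : A} (ha : a ∈ 𝒜 i) {l : List A} (hl : ∀ x ∈ l, ∃ k, x ∈ 𝒜 k)
    (hb : b ∈ 𝒜 j) : booleanCumulant φ (a :: (l ++ [b])) = 0 := by
  rw [booleanCumulant_cons_eq φ h1]
  exact map_eq_zero_of_mem_alternatingSpan hfree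
    (mul_mem_alternatingSpan h1 hij ha (centeredProd_mem_alternatingSpan h1 hfree hl hb))

/-! ### Alternating lists -/

theorem altList_append {A : Type*} (X Y : ℕ → A) {a i n : ℕ} (hai : a < i) (hin : i < n) :
    altList X Y a n = altList X Y a i ++ Y i :: altList X Y i n := by
  have h : List.Ico (a + 1) n = List.Ico (a + 1) i ++ i :: List.Ico (i + 1) n := by
    rw [← List.Ico.eq_cons hin, List.Ico.append_consecutive hai hin.le]
  simp [altList, h]

theorem altList_eq_cons {A : Type*} (X Y : ℕ → A) {a n : ℕ} (h : a < n) :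
    ∃ l, altList X Y a n = X (a + 1) :: l ∧
      ∀ x ∈ l, (∃ i ∈ Set.Ioc a n, x = X i) ∨ ∃ i ∈ Set.Ioo a n, x = Y i := by
  rcases (Nat.succ_le_of_lt h).eq_or_lt with rfl | h'
  · exact ⟨[], by simp [altList]⟩
  · refine ⟨Y (a + 1) :: altList X Y (a + 1) n, ?_, ?_⟩
    · rw [altList_append X Y (Nat.lt_succ_self a) h']
      simp [altList]
    · intro x hx
      simp only [altList, List.mem_cons, List.mem_append, List.mem_flatMap, List.Ico.mem,
        List.not_mem_nil, or_false] at hx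
      rcases hx with rfl | ⟨r, hr, rfl | rfl⟩ | rfl
      · exact .inr ⟨_, ⟨Nat.lt_succ_self a, h'⟩, rfl⟩
      · exact .inl ⟨r, ⟨by omega, by omega⟩, rfl⟩
      · exact .inr ⟨r, ⟨by omega, by omega⟩, rfl⟩
      · exact .inl ⟨n, ⟨h, le_rfl⟩, rfl⟩

theorem prod_map_mul_eq_prod_altList_mul {A : Type*} [Monoid A] (X Y : ℕ → A) {a n : ℕ} (h : a < n) :
    ((List.Ico (a + 1) (n + 1)).map (fun r => X r * Y r)).prod =
      (altList X Y a n).prod * Y n := by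
  rw [List.Ico.succ_top (by omega), altList, List.map_append, List.prod_append, List.prod_append,
    List.flatMap_def, List.prod_flatten, List.map_map]
  simp [Function.comp_def, mul_assoc]

theorem sum_range_two_mul {M : Type*} [AddCommMonoid M] (f : ℕ → M) (m : ℕ) :
    ∑ k ∈ Finset.range (2 * m), f k = ∑ k ∈ Finset.range m, (f (2 * k) + f (2 * k + 1)) := by
  induction m with
  | zero => simp
  | succ m ih =>
    rw [Nat.mul_succ, Finset.sum_range_succ, Finset.sum_range_succ, ih, Finset.sum_range_succ,
      add_assoc]

/-- Expansion of an alternating moment over the first block of the interval partition: by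
freeness, only the blocks that end at some `X i` contribute. -/
theorem moment_altList_mul_eq_sum (h1 : φ 1 = 1) (hfree : IsFree φ 𝒜) {i₀ i₁ : ι}
    (hne : i₀ ≠ i₁) {X Y : ℕ → A} {a n : ℕ} (han : a < n) (hX : ∀ i ∈ Set.Ioc a n, X i ∈ 𝒜 i₀)
    (hY : ∀ i ∈ Set.Ioo a n, Y i ∈ 𝒜 i₁) {b : A} (hb : b ∈ 𝒜 i₁) :
    φ ((altList X Y a n).prod * b) =
      (∑ i ∈ Finset.Ioo a n, booleanCumulant φ (altList X Y a i) *
        φ (Y i * (altList X Y i n).prod * b)) + booleanCumulant φ (altList X Y a n) * φ b := by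
  have vanish : ∀ i ∈ Set.Ioc a n, ∀ c ∈ 𝒜 i₁,
      booleanCumulant φ (altList X Y a i ++ [c]) = 0 := by
    intro i hi c hc
    obtain ⟨l, hl, hmem⟩ := altList_eq_cons X Y hi.1
    rw [hl, List.cons_append]
    refine booleanCumulant_eq_zero_of_isFree h1 hfree hne
      (hX _ ⟨Nat.lt_succ_self a, han⟩) (fun x hx => ?_) hc
    rcases hmem x hx with ⟨r, hr, rfl⟩ | ⟨r, hr, rfl⟩
    · exact ⟨i₀, hX r ⟨hr.1, hr.2.trans hi.2⟩⟩
    · exact ⟨i₁, hY r ⟨hr.1, hr.2.trans_le hi.2⟩⟩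
  have hlen : (altList X Y a n ++ [b]).length = 2 * (n - a) := by
    rw [List.length_append, length_altList X Y han, List.length_singleton]
    omega
  -- A block of odd length ends at an `X i`, one of even length at a `Y i` or at `b`.
  have term : ∀ i ∈ Set.Ioc a n, ∀ (c : A) (t : List A), c ∈ 𝒜 i₁ →
      altList X Y a n ++ [b] = altList X Y a i ++ c :: t → ∀ k, a + 1 + k = i →
      booleanCumulant φ ((altList X Y a n ++ [b]).take (2 * k + 1)) *
          φ ((altList X Y a n ++ [b]).drop (2 * k + 1)).prod +
        booleanCumulant φ ((altList X Y a n ++ [b]).take (2 * k + 1 + 1)) *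
          φ ((altList X Y a n ++ [b]).drop (2 * k + 1 + 1)).prod =
      booleanCumulant φ (altList X Y a i) * φ (c :: t).prod := by
    intro i hi c t hc e k hk
    have hli : (altList X Y a i).length = 2 * k + 1 := by
      rw [length_altList X Y hi.1]
      omega
    have e2 : altList X Y a n ++ [b] = (altList X Y a i ++ [c]) ++ t := by
      rw [e, List.append_assoc, List.singleton_append]
    have t1 : (altList X Y a n ++ [b]).take (2 * k + 1) = altList X Y a i := by
      rw [e, List.take_left' hli]
    have d1 : (altList X Y a n ++ [b]).drop (2 * k + 1) = c :: t := by
      rw [e, List.drop_left' hli]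
    have t2 : (altList X Y a n ++ [b]).take (2 * k + 1 + 1) = altList X Y a i ++ [c] := by
      rw [e2, List.take_left' (by simp [hli])]
    rw [t1, d1, t2, vanish i hi c hc, zero_mul, add_zero]
  have hrec := booleanCumulant_recursion φ h1 (altList X Y a n ++ [b]) (by simp)
  rw [← Finset.sum_range (fun k => booleanCumulant φ ((altList X Y a n ++ [b]).take (k + 1)) *
    φ ((altList X Y a n ++ [b]).drop (k + 1)).prod), hlen, sum_range_two_mul,
    List.prod_append, List.prod_singleton] at hrec
  obtain ⟨m, rfl⟩ : ∃ m, n = a + 1 + m := ⟨n - (a + 1), by omega⟩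
  have hm : a + 1 + m - a = m + 1 := by omega
  rw [hrec, hm, Finset.sum_range_succ, term (a + 1 + m) ⟨han, le_rfl⟩ b [] hb rfl m rfl,
    List.prod_singleton, add_left_inj]
  have hIoo : Finset.Ioo a (a + 1 + m) = Finset.Ico (a + 1) (a + 1 + m) := by
    ext; simp
  rw [hIoo, Finset.sum_Ico_eq_sum_range, Nat.add_sub_cancel_left]
  refine Finset.sum_congr rfl fun k hk => ?_
  have hk' := Finset.mem_range.1 hk
  rw [term (a + 1 + k) ⟨by omega, by omega⟩ (Y (a + 1 + k))
    (altList X Y (a + 1 + k) (a + 1 + m) ++ [b]) (hY _ ⟨by omega, by omega⟩) ?_ k rfl]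
  · simp [mul_assoc]
  · rw [altList_append X Y (i := a + 1 + k) (by omega) (by omega)]
    simp

/-! ### Sums over increasing sequences -/

/-- A sum over the increasing sequences in the open interval `(a, n)`, sorted by the first entry. -/
theorem sum_powerset_Ioo_sort {M : Type*} [AddCommMonoid M] (f : List ℕ → M) (a n : ℕ) :
    ∑ s ∈ (Finset.Ioo a n).powerset, f (s.sort (· ≤ ·)) =
      (∑ i ∈ Finset.Ioo a n, ∑ s ∈ (Finset.Ioo i n).powerset, f (i :: s.sort (· ≤ ·))) +
        f [] := by
  induction hd : n - a generalizing a with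
  | zero =>
    rw [Finset.Ioo_eq_empty (by omega)]
    simp
  | succ d ih =>
    by_cases h : a + 1 < n
    · have hI : Finset.Ioo a n = insert (a + 1) (Finset.Ioo (a + 1) n) := by
        ext x
        simp only [Finset.mem_insert, Finset.mem_Ioo]
        omega
      have hnot : a + 1 ∉ Finset.Ioo (a + 1) n := by simp
      rw [hI, Finset.sum_powerset_insert hnot, Finset.sum_insert hnot, ih (a + 1) (by omega),
        add_comm, ← add_assoc]
      congr 2
      refine Finset.sum_congr rfl fun s hs => ?_
      have hs' := Finset.mem_powerset.1 hs
      rw [Finset.sort_insert]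
      · intro b hb
        exact (Finset.mem_Ioo.1 (hs' hb)).1.le
      · exact fun hb => hnot (hs' hb)
    · have hI : Finset.Ioo a n = ∅ := by
        ext x
        simp only [Finset.mem_Ioo, Finset.notMem_empty, iff_false]
        omega
      simp [hI]

/-- The product of the cumulants `β (X_{i_j+1}, Y_{i_j+1}, …, X_{i_{j+1}})` for the sequence
`a = i₀, i₁, …, i_k, i_{k+1} = n`, where `[i₁, …, i_k]` is the given list. -/
noncomputable def listWeight (φ : A →ₗ[ℂ] ℂ) (X Y : ℕ → A) (n : ℕ) : ℕ → List ℕ → ℂ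
  | a, [] => booleanCumulant φ (altList X Y a n)
  | a, i :: l => booleanCumulant φ (altList X Y a i) * listWeight φ X Y n i l

theorem prod_range_eq_listWeight (X Y : ℕ → A) (n a : ℕ) (l : List ℕ) :
    ∏ j ∈ Finset.range (l.length + 1), booleanCumulant φ
      (altList X Y ((a :: (l ++ [n])).getD j 0) ((a :: (l ++ [n])).getD (j + 1) 0)) =
      listWeight φ X Y n a l := by
  induction l generalizing a with
  | nil => simp [listWeight]
  | cons i l ih =>
    rw [List.length_cons, Finset.prod_range_succ', listWeight, ← ih i, mul_comm]
    rfl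

theorem cumulantWeight_eq_listWeight (X Y : ℕ → A) (n : ℕ) (s : Finset ℕ) :
    cumulantWeight φ X Y n s = listWeight φ X Y n 0 (s.sort (· ≤ ·)) := by
  rw [← prod_range_eq_listWeight, Finset.length_sort]
  rfl

theorem sum_range_powersetCard_Ioo {M : Type*} [AddCommMonoid M] {n : ℕ} (hn : 1 ≤ n)
    (f : Finset ℕ → M) :
    ∑ k ∈ Finset.range n, ∑ s ∈ Finset.powersetCard k (Finset.Ioo 0 n), f s =
      ∑ s ∈ (Finset.Ioo 0 n).powerset, f s := by
  rw [Finset.sum_powerset, Nat.card_Ioo, Nat.sub_zero, Nat.sub_add_cancel hn]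

/-! ### The alternating moments -/

theorem moment_altList_mul (h1 : φ 1 = 1) (htr : ∀ a b : A, φ (a * b) = φ (b * a))
    (hfree : IsFree φ 𝒜) {i₀ i₁ : ι} (hne : i₀ ≠ i₁) {X Y : ℕ → A} {a n : ℕ} (han : a < n)
    (hX : ∀ i ∈ Set.Ioc a n, X i ∈ 𝒜 i₀) (hY : ∀ i ∈ Set.Ioo a n, Y i ∈ 𝒜 i₁) {b : A}
    (hb : b ∈ 𝒜 i₁) :
    φ ((altList X Y a n).prod * b) = ∑ s ∈ (Finset.Ioo a n).powerset,
      listWeight φ X Y n a (s.sort (· ≤ ·)) * φ (((s.sort (· ≤ ·)).map Y).prod * b) := by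
  induction hd : n - a using Nat.strong_induction_on generalizing a b with
  | _ d ih =>
    rw [sum_powerset_Ioo_sort (fun l => listWeight φ X Y n a l * φ ((l.map Y).prod * b)),
      moment_altList_mul_eq_sum h1 hfree hne han hX hY hb]
    simp only [listWeight, List.map_nil, List.prod_nil, one_mul, add_left_inj]
    refine Finset.sum_congr rfl fun i hi => ?_
    have hi' := Finset.mem_Ioo.1 hi
    -- By traciality `Y i` moves behind `b`, which leaves a moment of the same form.
    rw [mul_assoc, htr, mul_assoc, ih (n - i) (by omega) hi'.2
      (fun r hr => hX r ⟨hi'.1.trans hr.1, hr.2⟩) (fun r hr => hY r ⟨hi'.1.trans hr.1, hr.2⟩)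
      ((𝒜 i₁).mul_mem hb (hY i hi')) rfl, Finset.mul_sum]
    refine Finset.sum_congr rfl fun s _ => ?_
    rw [← mul_assoc _ b, htr _ (Y i), List.map_cons, List.prod_cons]
    simp only [mul_assoc]

end Algebraic

/-! ### Conditional expectations -/

theorem IsConditionalExpectation.isCondExpOf {A : Type*} [Ring A] [Algebra ℂ A] [StarRing A]
    [StarModule ℂ A] {φ : A →ₗ[ℂ] ℂ} {B : StarSubalgebra ℂ A} {E : A →ₗ[ℂ] A}
    (hE : IsConditionalExpectation φ B E) (a : A) : IsCondExpOf φ B a (E a) := by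
  refine ⟨hE.mem a, fun b hb => ?_⟩
  have h := hE.bimodule 1 B.one_mem b hb a
  rw [one_mul, one_mul] at h
  rw [← h, hE.preserves]

theorem IsCondExpOf.unique {A : Type*} [CStarAlgebra A] [PartialOrder A] [StarOrderedRing A]
    {φ : A →ₗ[ℂ] ℂ} (hφ : IsFaithfulNormalTracialState φ) {B : StarSubalgebra ℂ A} {a z z' : A}
    (hz : IsCondExpOf φ B a z) (hz' : IsCondExpOf φ B a z') : z = z' := by
  have hmem : star (z - z') ∈ B := star_mem (B.sub_mem hz.1 hz'.1)
  refine sub_eq_zero.1 (hφ.faithful _ ?_)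
  rw [hφ.tracial, sub_mul, map_sub, ← hz.2 _ hmem, ← hz'.2 _ hmem, sub_self]

end FreeProb

theorem proposition1p1 {A : Type*} [CStarAlgebra A] [WStarAlgebra A] [PartialOrder A]
    [StarOrderedRing A] (φ : A →ₗ[ℂ] ℂ) (hφ : FreeProb.IsFaithfulNormalTracialState φ)
    (n : ℕ) (hn : 1 ≤ n) (X Y : ℕ → A) :
    (FreeProb.IsFree φ ![Algebra.adjoin ℂ (X '' Set.Icc 1 n), Algebra.adjoin ℂ (Y '' Set.Icc 1 n)] →
      φ ((List.Ico 1 (n + 1)).map (fun r => X r * Y r)).prod =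
        ∑ k ∈ Finset.range n, ∑ s ∈ Finset.powersetCard k (Finset.Ioo 0 n),
          φ (FreeProb.orderedProd Y s * Y n) * FreeProb.cumulantWeight φ X Y n s) ∧
    (∀ B : StarSubalgebra ℂ A, (∀ i ∈ Set.Ico 1 n, Y i ∈ B) →
      FreeProb.IsFree φ ![Algebra.adjoin ℂ (X '' Set.Icc 1 n), B.toSubalgebra] →
      (∀ z : A, FreeProb.IsCondExpOf φ B (FreeProb.altList X Y 0 n).prod z ↔
        z = ∑ k ∈ Finset.range n, ∑ s ∈ Finset.powersetCard k (Finset.Ioo 0 n),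
          FreeProb.cumulantWeight φ X Y n s • FreeProb.orderedProd Y s) ∧
      (∀ E : A →ₗ[ℂ] A, FreeProb.IsConditionalExpectation φ B E →
        E (FreeProb.altList X Y 0 n).prod =
          ∑ k ∈ Finset.range n, ∑ s ∈ Finset.powersetCard k (Finset.Ioo 0 n),
            FreeProb.cumulantWeight φ X Y n s • FreeProb.orderedProd Y s)) := by
  have h1 := hφ.map_one
  have htr := hφ.tracial
  have h01 : (0 : Fin 2) ≠ 1 := by decide
  have hX : ∀ i ∈ Set.Ioc 0 n, X i ∈ Algebra.adjoin ℂ (X '' Set.Icc 1 n) := fun i hi =>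
    Algebra.subset_adjoin ⟨i, ⟨hi.1, hi.2⟩, rfl⟩
  refine ⟨fun hfree => ?_, fun B hB hfree => ?_⟩
  · have hY : ∀ i ∈ Set.Icc 1 n, Y i ∈ Algebra.adjoin ℂ (Y '' Set.Icc 1 n) := fun i hi =>
      Algebra.subset_adjoin ⟨i, hi, rfl⟩
    rw [FreeProb.sum_range_powersetCard_Ioo hn,
      FreeProb.prod_map_mul_eq_prod_altList_mul X Y (a := 0) hn,
      FreeProb.moment_altList_mul h1 htr hfree h01 hn hX
        (fun i hi => hY i ⟨hi.1, hi.2.le⟩) (hY n ⟨hn, le_rfl⟩)]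
    refine Finset.sum_congr rfl fun s _ => ?_
    rw [FreeProb.cumulantWeight_eq_listWeight, FreeProb.orderedProd, mul_comm]
  · rw [FreeProb.sum_range_powersetCard_Ioo hn]
    have key : FreeProb.IsCondExpOf φ B (FreeProb.altList X Y 0 n).prod
        (∑ s ∈ (Finset.Ioo 0 n).powerset,
          FreeProb.cumulantWeight φ X Y n s • FreeProb.orderedProd Y s) := by
      refine ⟨sum_mem fun s hs => B.smul_mem (list_prod_mem fun y hy => ?_) _, fun b hb => ?_⟩
      · obtain ⟨i, hi, rfl⟩ := List.mem_map.1 hy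
        exact hB i (Finset.mem_Ioo.1 (Finset.mem_powerset.1 hs ((Finset.mem_sort _).1 hi)))
      · rw [FreeProb.moment_altList_mul h1 htr hfree h01 hn hX (fun i hi => hB i hi) hb,
          Finset.sum_mul, map_sum]
        refine Finset.sum_congr rfl fun s _ => ?_
        rw [smul_mul_assoc, map_smul, smul_eq_mul, FreeProb.cumulantWeight_eq_listWeight,
          FreeProb.orderedProd]
    refine ⟨fun z => ⟨fun hz => hz.unique hφ key, fun hz => hz ▸ key⟩, fun E hE => ?_⟩
    exact (hE.isCondExpOf _).unique hφ key
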